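/- **Setting.** Let $A$ be an affine space over a real vector space $L$, with a map $\theta:A\times L\to\mathbb{R}$, linear in the second argument, and a bilinear form $[\cdot,\cdot]:L\times L\to\mathbb{R}$ such that $\theta(\eta+\xi,\tau)=\theta(\eta,\tau)+[\xi,\tau]$. Put $M:=\{\tau\in L:[\xi,\tau]=0\ \forall\xi\in L\}$ and $N:=\{\tau\in L:[\tau,\xi]=0\ \forall\xi\in L\}$. Assume that $\omega(\xi,\xi')=\frac12[\xi,\xi']-\frac12[\xi',\xi]$ is non-degenerate, that $M+N=L$, and that $\theta(\eta,\tau)=0$ for $\eta\in A$, $\tau\in M$. Let $Q:=L/M$ and $C:=A/M$ (an affine space over $Q$), with quotient maps $q:L\to Q$ and $c:A\to C$; then $\theta$ and $[\cdot,\cdot]$ descend to maps $A\times Q\to\mathbb{R}$ and $L\times Q\to\mathbb{R}$. Let $\Omega:Q\times Q\to\mathbb{C}$ be a symmetric real-bilinear form with positive definite real part which is admissible: $Q$ with the inner product $\Re\Omega$ is a separable Hilbert space, $\Im\Omega$ is continuous on it, and the continuous linear functionals on $Q$ are exactly the maps $\phi\mapsto[\xi,\phi]$ with $\xi\in L$.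 Let $\hat Q$ be the algebraic dual of the topological dual of $Q$, which contains $Q$ canonically, with the projective (initial) topology and the $\sigma$-algebra of cylinder sets; let $\nu_Q$ be the Gaussian measure on $\hat Q$, that is, the unique measure whose image on every finite-dimensional quotient $Q/W$ ($W\subseteq Q$ a closed subspace of finite codimension) is the probability measure with density proportional to $\exp(-\|\phi\|^2)$ with respect to Lebesgue measure, where $\|\cdot\|$ is the quotient norm. A function on $Q$ is almost translation invariant (cylindrical) if it is invariant under translations by some closed subspace $W$ of finite codimension; it then extends canonically to $\hat Q$ through the projection $\hat Q\to Q/W$. Let $\mathcal{L}^2(\hat Q,\nu_Q)$ be the space of square-integrable functions $\hat Q\to\mathbb{C}$ (functions, not equivalence classes) with the positive semi-definite inner product $\langle\chi,\psi\rangle=\int_{\hat Q}\psi\,\overline{\chi}\,\mathrm{d}\nu_Q$. For $\zeta\in A$ and $\varphi\in C$ put $$\hat K_\zeta(\varphi):=\exp\Big(\mathrm{i}\,\theta(\zeta,\varphi-c(\zeta))-\tfrac12\Omega(\varphi-c(\zeta),\varphi-c(\zeta))\Big).$$ The $\eta$-reduced wave function of $\Psi:C\to\mathbb{C}$ is the function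 $\Psi^\eta:Q\to\mathbb{C}$ determined by $\Psi(\varphi)=\Psi^{\eta}(\varphi-c(\eta))\,\hat K_\eta(\varphi)$. **Lemma.** Let $\eta,\eta'\in A$, and for $\phi\in Q$ put $\beta_{\eta,\eta'}(\phi):=\hat K_\eta(\phi+c(\eta'))/\hat K_{\eta'}(\phi+c(\eta'))$. 1. For all $\phi\in Q$, $$\beta_{\eta,\eta'}(\phi)=\exp\Big(\mathrm{i}\theta(\eta,\eta'-\eta)-\tfrac12\Omega(q(\eta'-\eta),q(\eta'-\eta))-\mathrm{i}[\eta'-\eta,\phi]-\Omega(q(\eta'-\eta),\phi)\Big),$$ and $\beta_{\eta,\eta'}$ is continuous and almost translation invariant on $Q$. Its canonical extension to $\hat Q$, again denoted $\beta_{\eta,\eta'}$, is well defined (independent of the choice of $W$), and it is the unique continuous function on $\hat Q$ that extends $\beta_{\eta,\eta'}$. 2. For all $\Psi:C\to\mathbb{C}$ and $\phi\in Q$, $\Psi^{\eta'}(\phi)=\Psi^{\eta}(\phi+q(\eta'-\eta))\,\beta_{\eta,\eta'}(\phi)$. If $\Psi^\eta$ is almost translation invariant then so is $\Psi^{\eta'}$,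 and the canonical extensions to $\hat Q$ satisfy the same formula for all $\phi\in\hat Q$. 3. For $\psi\in\mathcal{L}^2(\hat Q,\nu_Q)$, the function $\psi'(\phi):=\psi(\phi+q(\eta'-\eta))\,\beta_{\eta,\eta'}(\phi)$ on $\hat Q$ is an element of $\mathcal{L}^2(\hat Q,\nu_Q)$. The map $\psi\mapsto\psi'$ is an isometric isomorphism of $\mathcal{L}^2(\hat Q,\nu_Q)$: a bijective complex-linear map that preserves the inner product. -/

import Mathlib

open MeasureTheory ProbabilityTheory Complex

universe u

noncomputable section

namespace SchrodingerRep

/-! ### The extension of a real Hilbert space carrying its Gaussian measure -/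

section HilbertExtension

variable (E : Type*) [NormedAddCommGroup E] [InnerProductSpace ℝ E]

/-- The algebraic dual of the topological dual of `E`. -/
def Hat : Type _ := Module.Dual ℝ (StrongDual ℝ E)

instance : AddCommGroup (Hat E) := inferInstanceAs (AddCommGroup (Module.Dual ℝ (StrongDual ℝ E)))

instance : Module ℝ (Hat E) := inferInstanceAs (Module ℝ (Module.Dual ℝ (StrongDual ℝ E)))

variable {E}

/-- The value of a point of `Hat E` on a continuous linear functional. -/
def Hat.eval (Φ : Hat E) : Module.Dual ℝ (StrongDual ℝ E) := Φ

variable (E)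

/-- The projective topology: the coarsest one for which all evaluations at continuous linear
functionals (equivalently, all projections to finite-dimensional quotients) are continuous. -/
instance : TopologicalSpace (Hat E) :=
  TopologicalSpace.induced (fun Φ (l : StrongDual ℝ E) => Φ.eval l) inferInstance

/-- The σ-algebra of cylinder sets: the smallest one for which all evaluations at continuous linear
functionals (equivalently, all projections to finite-dimensional quotients) are measurable. -/
instance : MeasurableSpace (Hat E) :=
  MeasurableSpace.comap (fun Φ (l : StrongDual ℝ E) => Φ.eval l) inferInstance

/-- The canonical inclusion of `E` into the algebraic dual of its topological dual. -/
def incl : E →ₗ[ℝ] Hat E where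
  toFun x := (ContinuousLinearMap.apply ℝ ℝ x : StrongDual ℝ E →L[ℝ] ℝ).toLinearMap
  map_add' x y := by
    refine LinearMap.ext fun l => ?_
    exact map_add l x y
  map_smul' c x := by
    refine LinearMap.ext fun l => ?_
    exact map_smul l c x

/-- The closed subspaces of `E` of finite codimension. They index the finite-dimensional quotients
of `E`. -/
structure FinCodim where
  carrier : Submodule ℝ E
  isClosed : IsClosed (carrier : Set E)
  finiteDimensional : FiniteDimensional ℝ (E ⧸ carrier)

variable {E}

/-- The finite-dimensional quotient space belonging to a closed subspace of finite codimension. -/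
abbrev FinCodim.Quot (W : FinCodim E) : Type _ := E ⧸ W.carrier

instance (W : FinCodim E) : IsClosed (W.carrier : Set E) := W.isClosed

instance (W : FinCodim E) : FiniteDimensional ℝ W.Quot := W.finiteDimensional

instance (W : FinCodim E) : MeasurableSpace W.Quot := borel _

instance (W : FinCodim E) : BorelSpace W.Quot := ⟨rfl⟩

instance (W : FinCodim E) [CompleteSpace E] : CompleteSpace W.carrier :=
  W.isClosed.completeSpace_coe

/-- The pullback to `E` of a linear functional on a finite-dimensional quotient `E ⧸ W`. -/
def pullback (W : FinCodim E) : Module.Dual ℝ W.Quot →ₗ[ℝ] StrongDual ℝ E where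
  toFun l := (LinearMap.toContinuousLinearMap l).comp W.carrier.mkQL
  map_add' l l' := by ext x; rfl
  map_smul' c l := by ext x; rfl

/-- The canonical projection of `Hat E` onto a finite-dimensional quotient `E ⧸ W`: a point `Φ`
induces the functional `l ↦ Φ (l ∘ mk)` on the dual of `E ⧸ W`, that is, a point of the bidual
of `E ⧸ W`, which is `E ⧸ W` itself. -/
def proj (W : FinCodim E) : Hat E →ₗ[ℝ] W.Quot :=
  (Module.evalEquiv ℝ W.Quot).symm.toLinearMap ∘ₗ (pullback W).dualMap

theorem apply_proj (W : FinCodim E) (Φ : Hat E) (l : Module.Dual ℝ W.Quot) :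
    l (proj W Φ) = Φ.eval (pullback W l) :=
  Module.apply_evalEquiv_symm_apply ℝ W.Quot l ((pullback W).dualMap Φ)

/-- The centred Gaussian probability measure on a finite-dimensional Euclidean space `V` with
density proportional to `exp (-‖x‖ ^ 2)` with respect to the Lebesgue measure. -/
def gaussian (V : Type*) [NormedAddCommGroup V] [InnerProductSpace ℝ V] [FiniteDimensional ℝ V]
    [MeasurableSpace V] [BorelSpace V] : Measure V :=
  (∫⁻ x : V, ENNReal.ofReal (Real.exp (-‖x‖ ^ 2)))⁻¹ •
    (volume : Measure V).withDensity (fun x => ENNReal.ofReal (Real.exp (-‖x‖ ^ 2)))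

/-- `ν` is the projective limit of the Gaussian measures on the finite-dimensional quotients
of `E`. -/
def IsProjectiveGaussian [CompleteSpace E] (ν : Measure (Hat E)) : Prop :=
  ∀ W : FinCodim E, ν.map (proj W) = gaussian W.Quot

/-- A function on `E` descends to `E ⧸ W` if it is invariant under translations by `W`. -/
def DescendsTo (W : FinCodim E) (f : E → ℂ) : Prop :=
  ∀ x : E, ∀ w ∈ W.carrier, f (x + w) = f x

/-- A function on `E` is cylindrical, or almost translation invariant, if it is invariant under
translations by a closed subspace of finite codimension. -/
def IsCylindrical (f : E → ℂ) : Prop := ∃ W : FinCodim E, DescendsTo W f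

open Classical in
/-- The canonical extension of a cylindrical function `f` to `Hat E`: if `f` is induced from a
function on `E ⧸ W`, its extension is that function composed with `Hat E → E ⧸ W`. -/
def cylExtend (f : E → ℂ) (Φ : Hat E) : ℂ :=
  if h : IsCylindrical f then f (Quotient.out (proj h.choose Φ)) else 0

end HilbertExtension

section Existence

variable {E : Type*} [NormedAddCommGroup E] [InnerProductSpace ℝ E]

theorem measurable_eval (l : StrongDual ℝ E) : Measurable fun Φ : Hat E => Φ.eval l :=
  (measurable_pi_apply l).comp (comap_measurable (fun (Φ : Hat E) (l : StrongDual ℝ E) => Φ.eval l))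

theorem measurable_hat {S : Type*} [MeasurableSpace S] {f : S → Hat E}
    (h : ∀ l, Measurable fun s => (f s).eval l) : Measurable f := by
  rw [measurable_comap_iff]
  exact measurable_pi_iff.2 h

theorem measurable_proj (W : FinCodim E) : Measurable (proj W) := by
  let b := Module.finBasis ℝ W.Quot
  have h : (proj W : Hat E → W.Quot) = fun Φ => ∑ i, Φ.eval (pullback W (b.coord i)) • b i := by
    funext Φ
    conv_lhs => rw [← b.sum_repr (proj W Φ)]
    refine Finset.sum_congr rfl fun i _ => ?_
    rw [← apply_proj]
    rfl
  rw [h]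
  exact Finset.measurable_sum _ fun i _ => (measurable_eval _).smul_const _

section Gaussian

variable (V : Type*) [NormedAddCommGroup V] [InnerProductSpace ℝ V] [FiniteDimensional ℝ V]
    [MeasurableSpace V] [BorelSpace V]

theorem integrable_rexp_neg_sq : Integrable fun x : V => Real.exp (-‖x‖ ^ 2) := by
  have h := GaussianFourier.integrable_cexp_neg_mul_sq_norm_add (V := V) (b := 1) (by simp) 0 0
  have h2 := h.norm
  refine h2.congr (Filter.Eventually.of_forall fun x => ?_)
  simp only [Complex.norm_exp]
  congr 1
  simp [← Complex.ofReal_pow]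

theorem lintegral_gaussian_density :
    ∫⁻ x : V, ENNReal.ofReal (Real.exp (-‖x‖ ^ 2)) =
      ENNReal.ofReal (Real.pi ^ (Module.finrank ℝ V / 2 : ℝ)) := by
  rw [← ofReal_integral_eq_lintegral_ofReal (integrable_rexp_neg_sq V)
    (Filter.Eventually.of_forall fun x => (Real.exp_pos _).le)]
  have := GaussianFourier.integral_rexp_neg_mul_sq_norm (V := V) (b := 1) one_pos
  simp only [neg_mul, one_mul, div_one] at this
  rw [this]

instance isProbabilityMeasure_gaussian : IsProbabilityMeasure (gaussian V) := by
  constructor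
  rw [gaussian, Measure.smul_apply, withDensity_apply _ MeasurableSet.univ, Measure.restrict_univ,
    smul_eq_mul]
  refine ENNReal.inv_mul_cancel ?_ ?_
  · rw [lintegral_gaussian_density]
    simpa using Real.rpow_pos_of_pos Real.pi_pos _
  · rw [lintegral_gaussian_density]
    exact ENNReal.ofReal_ne_top

theorem charFun_gaussian (t : V) : charFun (gaussian V) t = cexp (-(‖t‖ ^ 2 / 4 : ℝ)) := by
  have hm : Measurable fun x : V => ENNReal.ofReal (Real.exp (-‖x‖ ^ 2)) := by fun_prop
  rw [charFun_apply, gaussian, integral_smul_measure, lintegral_gaussian_density,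
    integral_withDensity_eq_integral_toReal_smul hm
      (Filter.Eventually.of_forall fun x => ENNReal.ofReal_lt_top)]
  have h := GaussianFourier.integral_cexp_neg_mul_sq_norm_add (V := V) (b := 1) (by simp) I t
  have h2 : (∫ x : V, (ENNReal.ofReal (Real.exp (-‖x‖ ^ 2))).toReal •
      cexp ((inner ℝ x t : ℝ) * I)) = ∫ v : V, cexp (-1 * (‖v‖ : ℂ) ^ 2 + I * (inner ℝ t v : ℝ)) := by
    refine integral_congr_ae (Filter.Eventually.of_forall fun x => ?_)
    simp only
    rw [ENNReal.toReal_ofReal (Real.exp_pos _).le, Complex.real_smul, Complex.ofReal_exp,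
      ← Complex.exp_add, real_inner_comm]
    congr 1
    push_cast
    ring
  rw [h2, h]
  have hp : (0 : ℝ) < Real.pi ^ (Module.finrank ℝ V / 2 : ℝ) := Real.rpow_pos_of_pos Real.pi_pos _
  rw [ENNReal.toReal_inv, ENNReal.toReal_ofReal hp.le, Complex.real_smul, div_one]
  have hc : (Real.pi : ℂ) ^ (Module.finrank ℝ V / 2 : ℂ) =
      ((Real.pi ^ (Module.finrank ℝ V / 2 : ℝ) : ℝ) : ℂ) := by
    rw [Complex.ofReal_cpow Real.pi_pos.le]
    push_cast
    rfl
  rw [hc, ← mul_assoc, ← Complex.ofReal_mul, inv_mul_cancel₀ hp.ne', Complex.ofReal_one, one_mul]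
  congr 1
  push_cast
  rw [Complex.I_sq]
  ring

end Gaussian

/-- The functional on `E` induced by `⟪·, t⟫` on a quotient has norm `‖t‖`. -/
theorem norm_pullback_inner [CompleteSpace E] (W : FinCodim E) (t : W.Quot) :
    ‖pullback W (innerₛₗ ℝ t)‖ = ‖t‖ := by
  refine le_antisymm (ContinuousLinearMap.opNorm_le_bound _ (norm_nonneg _) fun x => ?_) ?_
  · calc ‖inner ℝ t (W.carrier.mkQ x)‖ ≤ ‖t‖ * ‖W.carrier.mkQ x‖ := norm_inner_le_norm _ _
      _ ≤ ‖t‖ * ‖x‖ := by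
        gcongr
        exact Submodule.Quotient.norm_mk_le W.carrier x
  · rcases eq_or_ne t 0 with rfl | ht
    · simp
    let e := W.carrier.quotientEquivOrthogonal
    have h1 : W.carrier.mkQ ((e t : W.carrierᗮ) : E) = t := by
      have := W.carrier.quotientEquivOrthogonal_symm_eq_mk (e t : E) (e t).2
      rw [Submodule.mkQ_apply, ← this]
      exact e.symm_apply_apply t
    have h2 : ‖((e t : W.carrierᗮ) : E)‖ = ‖t‖ := by
      exact e.norm_map t
    have h3 := (pullback W (innerₛₗ ℝ t)).le_opNorm ((e t : W.carrierᗮ) : E)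
    have h4 : pullback W (innerₛₗ ℝ t) ((e t : W.carrierᗮ) : E) = ‖t‖ ^ 2 := by
      change inner ℝ t (W.carrier.mkQ ((e t : W.carrierᗮ) : E)) = _
      rw [h1, real_inner_self_eq_norm_sq]
    rw [h4, h2] at h3
    have h5 : 0 < ‖t‖ := norm_pos_iff.2 ht
    have h6 : ‖t‖ ^ 2 ≤ ‖pullback W (innerₛₗ ℝ t)‖ * ‖t‖ := by
      simpa using h3
    nlinarith

theorem isProjectiveGaussian_of_charFun [CompleteSpace E] (ν : Measure (Hat E)) [IsFiniteMeasure ν]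
    (h : ∀ l : StrongDual ℝ E, ∫ Φ, cexp ((Φ.eval l : ℝ) * I) ∂ν = cexp (-(‖l‖ ^ 2 / 4 : ℝ))) :
    IsProjectiveGaussian ν := by
  intro W
  have : IsFiniteMeasure (ν.map (proj W)) := Measure.isFiniteMeasure_map _ _
  refine Measure.ext_of_charFun ?_
  funext t
  rw [charFun_gaussian, charFun_apply, integral_map (measurable_proj W).aemeasurable
    (by fun_prop)]
  rw [← norm_pullback_inner W t, ← h]
  refine integral_congr_ae (Filter.Eventually.of_forall fun Φ => ?_)
  simp only
  rw [← apply_proj, real_inner_comm]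
  rfl

theorem continuous_charFun_lp {S : Type*} [MeasurableSpace S] (P : Measure S)
    [IsProbabilityMeasure P] :
    Continuous fun U : Lp ℝ 2 P => ∫ s, cexp ((U s : ℝ) * I) ∂P := by
  have key : ∀ U : Lp ℝ 2 P, Integrable (fun s => cexp ((U s : ℝ) * I)) P := fun U => by
    refine Integrable.of_bound (C := 1) ?_ (Filter.Eventually.of_forall fun s => ?_)
    · have := (Lp.aestronglyMeasurable U).aemeasurable
      exact (by fun_prop : AEMeasurable (fun s => cexp ((U s : ℝ) * I)) P).aestronglyMeasurable
    · rw [Complex.norm_exp_ofReal_mul_I]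
  refine LipschitzWith.continuous (K := 1) (LipschitzWith.of_dist_le_mul fun U V => ?_)
  rw [NNReal.coe_one, one_mul, dist_eq_norm, dist_eq_norm, ← integral_sub (key U) (key V)]
  have hW : MemLp (fun s => (U - V) s) 2 P := Lp.memLp (U - V)
  calc ‖∫ s, (cexp ((U s : ℝ) * I) - cexp ((V s : ℝ) * I)) ∂P‖
      ≤ ∫ s, ‖cexp ((U s : ℝ) * I) - cexp ((V s : ℝ) * I)‖ ∂P := norm_integral_le_integral_norm _
    _ ≤ ∫ s, ‖(U - V) s‖ ∂P := by
      refine integral_mono_ae ((key U).sub (key V)).norm (hW.integrable one_le_two).norm ?_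
      filter_upwards [Lp.coeFn_sub U V] with s hs
      rw [hs, Pi.sub_apply]
      have h1 : cexp ((U s : ℝ) * I) - cexp ((V s : ℝ) * I) =
          cexp ((V s : ℝ) * I) * (cexp (I * ((U s - V s : ℝ) : ℂ)) - 1) := by
        rw [mul_sub, mul_one, ← Complex.exp_add]
        congr 2
        push_cast
        ring
      rw [h1, norm_mul, Complex.norm_exp_ofReal_mul_I, one_mul]
      exact Real.norm_exp_I_mul_ofReal_sub_one_le
    _ ≤ ‖U - V‖ := by
      rw [integral_norm_eq_lintegral_enorm hW.1, Lp.norm_def, ← eLpNorm_one_eq_lintegral_enorm]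
      exact ENNReal.toReal_mono (Lp.eLpNorm_ne_top _)
        (eLpNorm_le_eLpNorm_of_exponent_le one_le_two hW.1)

section White

variable {w : Type*}

theorem memLp_coord (i : w) :
    MemLp (fun s : w → ℝ => s i) 2 (Measure.infinitePi fun _ : w => gaussianReal 0 1) :=
  MemLp.comp_measurePreserving (g := id) (memLp_id_gaussianReal' 2 (by simp))
    (measurePreserving_eval_infinitePi (fun _ : w => gaussianReal 0 1) i)

/-- The coordinates of white noise as square-integrable random variables. -/
def coordLp (i : w) : Lp ℝ 2 (Measure.infinitePi fun _ : w => gaussianReal 0 1) :=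
  (memLp_coord i).toLp

theorem coeFn_coordLp (i : w) : coordLp i
    =ᵐ[Measure.infinitePi fun _ : w => gaussianReal 0 1] fun s => s i :=
  (memLp_coord i).coeFn_toLp

theorem orthonormal_coord : Orthonormal ℝ (coordLp (w := w)) := by
  classical
  have hind : iIndepFun (fun (i : w) (s : w → ℝ) => s i)
      (Measure.infinitePi fun _ : w => gaussianReal 0 1) :=
    iIndepFun_infinitePi (X := fun _ x => x) (by fun_prop)
  have hmean : ∀ i : w, ∫ s, s i ∂(Measure.infinitePi fun _ : w => gaussianReal 0 1) = 0 := by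
    intro i
    have h := (measurePreserving_eval_infinitePi (fun _ : w => gaussianReal 0 1) i)
    rw [← integral_map (f := fun x : ℝ => x) (φ := fun s : w → ℝ => s i)
      (measurable_pi_apply i).aemeasurable (by fun_prop)]
    have h2 := h.map_eq
    change Measure.map (fun s : w → ℝ => s i) _ = _ at h2
    rw [h2, integral_id_gaussianReal]
  have hvar : ∀ i : w, ∫ s, s i * s i ∂(Measure.infinitePi fun _ : w => gaussianReal 0 1) = 1 := by
    intro i
    have h := (measurePreserving_eval_infinitePi (fun _ : w => gaussianReal 0 1) i)
    rw [← integral_map (f := fun x : ℝ => x * x) (φ := fun s : w → ℝ => s i)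
      (measurable_pi_apply i).aemeasurable (by fun_prop)]
    have h2 := h.map_eq
    change Measure.map (fun s : w → ℝ => s i) _ = _ at h2
    rw [h2]
    have h3 : Var[fun x : ℝ => x; gaussianReal 0 1] = 1 := by simp [variance_fun_id_gaussianReal]
    rw [variance_of_integral_eq_zero (by fun_prop) (by simp [integral_id_gaussianReal])] at h3
    simpa [pow_two] using h3
  rw [orthonormal_iff_ite]
  intro i j
  rw [L2.inner_def]
  have h : ∫ s, inner ℝ (coordLp i s) (coordLp j s)
      ∂(Measure.infinitePi fun _ : w => gaussianReal 0 1) =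
      ∫ s : w → ℝ, s i * s j ∂(Measure.infinitePi fun _ : w => gaussianReal 0 1) := by
    refine integral_congr_ae ?_
    filter_upwards [coeFn_coordLp i, coeFn_coordLp j] with s h1 h2
    rw [h1, h2]
    simp [mul_comm]
  rw [h]
  split_ifs with hij
  · subst hij; exact hvar i
  · rw [(hind.indepFun hij).integral_fun_mul_eq_mul_integral
      (measurable_pi_apply i).aestronglyMeasurable (measurable_pi_apply j).aestronglyMeasurable, hmean,
      zero_mul]

theorem charFun_finite_sum (s : Finset w) (a : w → ℝ) :
    ∫ ω : w → ℝ, cexp (((∑ i ∈ s, a i * ω i : ℝ) : ℂ) * I)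
      ∂(Measure.infinitePi fun _ : w => gaussianReal 0 1) =
      cexp (-((∑ i ∈ s, a i ^ 2) / 2 : ℝ)) := by
  have hind : iIndepFun (fun (i : w) (ω : w → ℝ) => a i * ω i)
      (Measure.infinitePi fun _ : w => gaussianReal 0 1) :=
    iIndepFun_infinitePi (X := fun i x => a i * x) (by fun_prop)
  have hm : ∀ i : w, Measurable fun ω : w → ℝ => a i * ω i := fun i =>
    (measurable_const_mul (a i)).comp (measurable_pi_apply i)
  have h := iIndepFun.charFun_map_fun_finsetSum_eq_prod (s := s)
    (fun i _ => (hm i).aemeasurable) (hind.restrict s)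
  have h1 := congrFun h 1
  rw [charFun_apply, integral_map (Finset.measurable_sum _ fun i _ => hm i).aemeasurable
    (by fun_prop)] at h1
  simp only [RCLike.inner_apply, conj_trivial, one_mul, Finset.prod_apply] at h1
  rw [h1]
  have h2 : ∀ i ∈ s, charFun (Measure.map (fun ω : w → ℝ => a i * ω i)
      (Measure.infinitePi fun _ : w => gaussianReal 0 1)) 1 = cexp (-(a i ^ 2 / 2 : ℝ)) := by
    intro i _
    have h3 : Measure.map (fun ω : w → ℝ => a i * ω i)
        (Measure.infinitePi fun _ : w => gaussianReal 0 1) = (gaussianReal 0 1).map (a i * ·) := by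
      have h4 := (measurePreserving_eval_infinitePi (fun _ : w => gaussianReal 0 1) i).map_eq
      change Measure.map (fun s : w → ℝ => s i) _ = _ at h4
      conv_rhs => rw [← h4]
      exact (Measure.map_map (measurable_const_mul (a i)) (measurable_pi_apply i)).symm
    rw [h3, gaussianReal_map_const_mul, charFun_gaussianReal]
    congr 1
    simp
    try ring
  rw [Finset.prod_congr rfl h2, ← Complex.exp_sum]
  congr 1
  push_cast
  rw [Finset.sum_neg_distrib, Finset.sum_div]

end White

theorem coeFn_finsetSum {S ι : Type*} [MeasurableSpace S] {P : Measure S} (s : Finset ι)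
    (f : ι → Lp ℝ 2 P) : ((∑ i ∈ s, f i : Lp ℝ 2 P) : S → ℝ) =ᵐ[P] ∑ i ∈ s, (f i : S → ℝ) := by
  classical
  induction s using Finset.induction_on with
  | empty => simpa using Lp.coeFn_zero ℝ 2 P
  | insert i s hi ih =>
    rw [Finset.sum_insert hi, Finset.sum_insert hi]
    exact (Lp.coeFn_add _ _).trans (Filter.EventuallyEq.rfl.add ih)

theorem exists_isonormal (E : Type u) [NormedAddCommGroup E] [InnerProductSpace ℝ E]
    [CompleteSpace E] :
    ∃ (S : Type u) (_ : MeasurableSpace S) (P : Measure S) (_ : IsProbabilityMeasure P)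
      (T : E →ₗᵢ[ℝ] Lp ℝ 2 P),
      ∀ x : E, ∫ s, cexp ((T x s : ℝ) * I) ∂P = cexp (-(‖x‖ ^ 2 / 2 : ℝ)) := by
  classical
  obtain ⟨w, b, -⟩ := exists_hilbertBasis ℝ E
  let P : Measure (w → ℝ) := Measure.infinitePi fun _ : w => gaussianReal 0 1
  let T : E →ₗᵢ[ℝ] Lp ℝ 2 P :=
    (orthonormal_coord (w := w)).orthogonalFamily.linearIsometry.comp b.repr.toLinearIsometry
  have hT : ∀ i, T (b i) = coordLp i := by
    intro i
    change (orthonormal_coord (w := w)).orthogonalFamily.linearIsometry (b.repr (b i)) = _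
    rw [HilbertBasis.repr_self, OrthogonalFamily.linearIsometry_apply_single]
    simp
  refine ⟨w → ℝ, inferInstance, P, inferInstance, T, fun x => ?_⟩
  have hsum := b.hasSum_repr x
  have h1 : Filter.Tendsto (fun s : Finset w =>
      ∫ ω, cexp ((T (∑ i ∈ s, b.repr x i • b i) ω : ℝ) * I) ∂P) Filter.atTop
      (nhds (∫ ω, cexp ((T x ω : ℝ) * I) ∂P)) :=
    (((continuous_charFun_lp P).comp T.continuous).tendsto x).comp hsum
  have h2 : Filter.Tendsto (fun s : Finset w =>
      cexp (-(‖∑ i ∈ s, b.repr x i • b i‖ ^ 2 / 2 : ℝ))) Filter.atTop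
      (nhds (cexp (-(‖x‖ ^ 2 / 2 : ℝ)))) :=
    ((by fun_prop : Continuous fun y : E => cexp (-(‖y‖ ^ 2 / 2 : ℝ))).tendsto x).comp hsum
  refine tendsto_nhds_unique h1 (h2.congr fun s => ?_)
  have hn : ‖∑ i ∈ s, b.repr x i • b i‖ ^ 2 = ∑ i ∈ s, (b.repr x i) ^ 2 := by
    rw [← real_inner_self_eq_norm_sq, b.orthonormal.inner_sum]
    simp [pow_two]
  rw [hn, ← charFun_finite_sum]
  refine integral_congr_ae ?_
  have hae : ∀ᵐ ω ∂P, ∀ i ∈ s, (coordLp i : Lp ℝ 2 P) ω = ω i := by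
    rw [Finset.eventually_all]
    exact fun i _ => coeFn_coordLp i
  have hsm : T (∑ i ∈ s, b.repr x i • b i) =
      ∑ i ∈ s, b.repr x i • coordLp i := by
    rw [map_sum]
    exact Finset.sum_congr rfl fun i _ => by rw [map_smul, hT]
  rw [hsm]
  have hae2 : ∀ᵐ ω ∂P, ∀ i ∈ s, (b.repr x i • coordLp i : Lp ℝ 2 P) ω =
      b.repr x i • (coordLp i : Lp ℝ 2 P) ω := by
    rw [Finset.eventually_all]
    exact fun i _ => Lp.coeFn_smul _ _
  filter_upwards [hae, hae2, coeFn_finsetSum s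
    (fun i => (b.repr x i • coordLp i : Lp ℝ 2 P))] with ω ha hb hc
  rw [hc, Finset.sum_apply]
  congr 3
  refine Finset.sum_congr rfl fun i hi => ?_
  rw [hb i hi, ha i hi, smul_eq_mul]

theorem exists_gaussian (E : Type*) [NormedAddCommGroup E] [InnerProductSpace ℝ E]
    [CompleteSpace E] : ∃ ν : Measure (Hat E), IsProbabilityMeasure ν ∧
      ∀ l : StrongDual ℝ E, ∫ Φ, cexp ((Φ.eval l : ℝ) * I) ∂ν = cexp (-(‖l‖ ^ 2 / 4 : ℝ)) := by
  obtain ⟨S, _, P, _, T, hT⟩ := exists_isonormal E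
  let G : StrongDual ℝ E →ₗ[ℝ] Lp ℝ 2 P :=
    T.toLinearMap ∘ₗ ((√2 : ℝ)⁻¹ • (InnerProductSpace.toDual ℝ E).symm.toLinearEquiv.toLinearMap)
  let b := Module.Basis.ofVectorSpace ℝ (StrongDual ℝ E)
  let Φ : S → Hat E := fun s => b.constr ℝ fun i => G (b i) s
  have heval : ∀ l s, (Φ s).eval l = ∑ i ∈ (b.repr l).support, b.repr l i * G (b i) s := by
    intro l s
    change b.constr ℝ (fun i => G (b i) s) l = _
    rw [Module.Basis.constr_apply]
    rfl
  have hmeas : Measurable Φ := measurable_hat fun l => by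
    simp_rw [heval l]
    exact Finset.measurable_sum _ fun i _ =>
      (Lp.stronglyMeasurable (G (b i))).measurable.const_mul _
  refine ⟨P.map Φ, Measure.isProbabilityMeasure_map hmeas.aemeasurable, fun l => ?_⟩
  have hm : AEStronglyMeasurable (fun Ψ : Hat E => cexp ((Ψ.eval l : ℝ) * I)) (P.map Φ) := by
    have := measurable_eval l
    exact (by fun_prop : Measurable fun Ψ : Hat E => cexp ((Ψ.eval l : ℝ) * I)).aestronglyMeasurable
  rw [integral_map hmeas.aemeasurable hm]
  have hx := hT ((√2 : ℝ)⁻¹ • (InnerProductSpace.toDual ℝ E).symm l)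
  have hn : ‖(√2 : ℝ)⁻¹ • (InnerProductSpace.toDual ℝ E).symm l‖ ^ 2 / 2 = ‖l‖ ^ 2 / 4 := by
    rw [norm_smul, LinearIsometryEquiv.norm_map, mul_pow, norm_inv, inv_pow, Real.norm_eq_abs,
      sq_abs, Real.sq_sqrt zero_le_two]
    ring
  rw [← hn, ← hx]
  refine integral_congr_ae ?_
  have hG : G l = ∑ i ∈ (b.repr l).support, b.repr l i • G (b i) := by
    conv_lhs => rw [← b.linearCombination_repr l, Finsupp.linearCombination_apply, Finsupp.sum,
      map_sum]
    exact Finset.sum_congr rfl fun i _ => map_smul _ _ _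
  have hae : ∀ᵐ s ∂P, ∀ i ∈ (b.repr l).support, (b.repr l i • G (b i) : Lp ℝ 2 P) s =
      b.repr l i • (G (b i) : Lp ℝ 2 P) s := by
    rw [Finset.eventually_all]
    exact fun i _ => Lp.coeFn_smul _ _
  filter_upwards [hae, coeFn_finsetSum (b.repr l).support
    (fun i => (b.repr l i • G (b i) : Lp ℝ 2 P))] with s ha hc
  have h1 : (T ((√2 : ℝ)⁻¹ • (InnerProductSpace.toDual ℝ E).symm l) : Lp ℝ 2 P) = G l := rfl
  rw [heval, h1, hG, hc, Finset.sum_apply]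
  congr 3
  exact Finset.sum_congr rfl fun i hi => by rw [ha i hi, smul_eq_mul]

/-- The common kernel of finitely many continuous linear functionals. -/
def commonKer (I : Finset (StrongDual ℝ E)) : FinCodim E where
  carrier := (ContinuousLinearMap.pi fun l : I => (l : StrongDual ℝ E)).ker
  isClosed := ContinuousLinearMap.isClosed_ker _
  finiteDimensional :=
    (LinearMap.quotKerEquivRange
      (ContinuousLinearMap.pi fun l : I => (l : StrongDual ℝ E)).toLinearMap).symm.finiteDimensional

theorem exists_pullback_eq (I : Finset (StrongDual ℝ E)) (l : I) :
    ∃ l' : Module.Dual ℝ (commonKer I).Quot, pullback (commonKer I) l' = l := by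
  refine ⟨(commonKer I).carrier.liftQ (l : StrongDual ℝ E).toLinearMap fun x hx => ?_, ?_⟩
  · exact congrFun (LinearMap.mem_ker.1 hx) l
  · ext x
    rfl

theorem isProbabilityMeasure_of_isProjectiveGaussian [CompleteSpace E] {ν : Measure (Hat E)}
    (h : IsProjectiveGaussian ν) : IsProbabilityMeasure ν := by
  have h1 : IsProbabilityMeasure (ν.map (proj (commonKer (∅ : Finset (StrongDual ℝ E))))) := by
    rw [h]
    infer_instance
  exact (Measure.isProbabilityMeasure_map_iff (measurable_proj _).aemeasurable).1 h1

theorem isProjectiveGaussian_unique [CompleteSpace E] {ν ν' : Measure (Hat E)}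
    (h : IsProjectiveGaussian ν) (h' : IsProjectiveGaussian ν') : ν = ν' := by
  have := isProbabilityMeasure_of_isProjectiveGaussian h
  have := isProbabilityMeasure_of_isProjectiveGaussian h'
  let e : Hat E → StrongDual ℝ E → ℝ := fun Φ l => Φ.eval l
  have he : Measurable e := comap_measurable _
  have key : ν.map e = ν'.map e := by
    have : ∀ I : Finset (StrongDual ℝ E), IsFiniteMeasure ((ν'.map e).map I.restrict) :=
      fun I => inferInstance
    refine IsProjectiveLimit.unique (P := fun I => (ν'.map e).map I.restrict) (fun I => ?_)
      (fun I => rfl)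
    choose g hg using exists_pullback_eq I
    have hf : I.restrict ∘ e = (fun x l => g l x) ∘ proj (commonKer I) := by
      funext Φ l
      change Φ.eval l = g l (proj (commonKer I) Φ)
      rw [apply_proj, hg]
    have hgm : Measurable fun (x : (commonKer I).Quot) (l : I) => g l x :=
      measurable_pi_iff.2 fun l => (LinearMap.continuous_of_finiteDimensional (g l)).measurable
    change (ν.map e).map I.restrict = (ν'.map e).map I.restrict
    rw [Measure.map_map (by fun_prop) he, Measure.map_map (by fun_prop) he, hf,
      ← Measure.map_map hgm (measurable_proj _), ← Measure.map_map hgm (measurable_proj _), h, h']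
  refine Measure.ext fun s hs => ?_
  obtain ⟨t, ht, rfl⟩ := hs
  change ν (e ⁻¹' t) = ν' (e ⁻¹' t)
  rw [← Measure.map_apply he ht, key, Measure.map_apply he ht]

theorem existsUnique_projectiveGaussian (E : Type*) [NormedAddCommGroup E] [InnerProductSpace ℝ E]
    [CompleteSpace E] : ∃! ν : Measure (Hat E), IsProjectiveGaussian ν := by
  obtain ⟨ν, _, hν⟩ := exists_gaussian E
  exact ⟨ν, isProjectiveGaussian_of_charFun ν hν,
    fun ν' h => isProjectiveGaussian_unique h (isProjectiveGaussian_of_charFun ν hν)⟩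

end Existence

/-- The Gaussian measure on the extension `Hat E` of a real Hilbert space `E`: the unique measure
which projects to the Gaussian measures on all finite-dimensional quotients of `E`. -/
def gaussianHat (E : Type*) [NormedAddCommGroup E] [InnerProductSpace ℝ E] [CompleteSpace E] :
    Measure (Hat E) :=
  (existsUnique_projectiveGaussian E).choose

/-- The space of square-integrable functions (not equivalence classes) on `Hat E`. -/
def SqInt (E : Type*) [NormedAddCommGroup E] [InnerProductSpace ℝ E] [CompleteSpace E] :
    Submodule ℂ (Hat E → ℂ) where
  carrier := {ψ | MemLp ψ 2 (gaussianHat E)}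
  zero_mem' := MemLp.zero
  add_mem' := fun h h' => MemLp.add h h'
  smul_mem' := fun c _ h => MemLp.const_smul h c

/-- The positive semi-definite inner product of square-integrable functions. -/
def innerProd {E : Type*} [NormedAddCommGroup E] [InnerProductSpace ℝ E] [CompleteSpace E]
    (χ ψ : Hat E → ℂ) : ℂ :=
  ∫ Φ, ψ Φ * starRingEnd ℂ (χ Φ) ∂(gaussianHat E)

/-! ### Affine field theory -/

/-- The quotient of an affine space `A` over `L` by a linear subspace `M` of `L`. -/
def quotSetoid {L : Type*} [AddCommGroup L] [Module ℝ L] (M : Submodule ℝ L) (A : Type*)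
    [AddTorsor L A] : Setoid A where
  r a b := a -ᵥ b ∈ M
  iseqv :=
    { refl := fun a => by simp
      symm := fun {a b} h => by
        rw [← neg_vsub_eq_vsub_rev]; exact M.neg_mem h
      trans := fun {a b c} h h' => by
        rw [← vsub_add_vsub_cancel a b c]; exact M.add_mem h h' }

/-- The classical data: an affine space `A` of solutions over the real vector space `L`, a
symplectic potential `θ` which is equivariant through a bilinear form `bracket` on `L`. -/
structure PotentialData (A L : Type*) [AddCommGroup L] [Module ℝ L] [AddTorsor L A] where
  θ : A → L →ₗ[ℝ] ℝ
  bracket : L →ₗ[ℝ] L →ₗ[ℝ] ℝ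
  equivariant : ∀ (η : A) (ξ τ : L), θ (ξ +ᵥ η) τ = θ η τ + bracket ξ τ

namespace PotentialData

variable {A L : Type*} [AddCommGroup L] [Module ℝ L] [AddTorsor L A] (F : PotentialData A L)

/-- The symplectic form. -/
def ω (ξ ξ' : L) : ℝ := 1 / 2 * F.bracket ξ ξ' - 1 / 2 * F.bracket ξ' ξ

/-- The subspace `M` of momentum directions. -/
def M : Submodule ℝ L where
  carrier := {τ | ∀ ξ, F.bracket ξ τ = 0}
  zero_mem' := by simp
  add_mem' := by intro a b ha hb ξ; simp [ha ξ, hb ξ]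
  smul_mem' := by intro c a ha ξ; simp [ha ξ]

/-- The complementary subspace `N`. -/
def N : Submodule ℝ L where
  carrier := {τ | ∀ ξ, F.bracket τ ξ = 0}
  zero_mem' := by simp
  add_mem' := by intro a b ha hb ξ; simp [ha ξ, hb ξ]
  smul_mem' := by intro c a ha ξ; simp [ha ξ]

end PotentialData

/-- An affine field theory: the symplectic form is non-degenerate, `M` and `N` generate `L`, and
the symplectic potential is adapted to the Schrödinger polarization defined by `M`. -/
structure AffineFieldTheory (A L : Type*) [AddCommGroup L] [Module ℝ L] [AddTorsor L A] extends
    PotentialData A L where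
  nondegenerate : ∀ ξ : L, (∀ ξ' : L, toPotentialData.ω ξ ξ' = 0) → ξ = 0
  generate : toPotentialData.M ⊔ toPotentialData.N = ⊤
  adapted : ∀ (η : A), ∀ τ ∈ toPotentialData.M, θ η τ = 0

/-- An affine field theory with a symmetric real-bilinear form `Ω : Q × Q → ℂ` on the space
`Q = L ⧸ M`, with positive definite real part. -/
structure SchrodingerData (A L : Type*) [AddCommGroup L] [Module ℝ L] [AddTorsor L A] extends
    AffineFieldTheory A L where
  Ω : (L ⧸ toAffineFieldTheory.M) →ₗ[ℝ] (L ⧸ toAffineFieldTheory.M) →ₗ[ℝ] ℂ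
  symm : ∀ φ φ', Ω φ φ' = Ω φ' φ
  pos : ∀ φ, φ ≠ 0 → 0 < (Ω φ φ).re

namespace SchrodingerData

variable {A L : Type*} [AddCommGroup L] [Module ℝ L] [AddTorsor L A] (D : SchrodingerData A L)

/-- The space `Q = L ⧸ M`. -/
def Q : Type _ := L ⧸ D.M

/-- The affine space `C = A ⧸ M` of field configurations. -/
def C : Type _ := Quotient (quotSetoid D.M A)

/-- The real part of `Ω` as an inner product on `Q`. -/
@[reducible]
def core : InnerProductSpace.Core ℝ (L ⧸ D.M) where
  inner φ φ' := (D.Ω φ φ').re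
  conj_inner_symm φ φ' := by simp [D.symm φ φ']
  re_inner_nonneg φ := by
    rcases eq_or_ne φ 0 with rfl | h
    · simp
    · exact (D.pos φ h).le
  add_left φ φ' ψ := by simp
  smul_left φ φ' c := by simp
  definite φ h := by
    by_contra h'
    exact (D.pos φ h').ne' h

/-- The norm on `Q` given by the real part of `Ω`. -/
instance : NormedAddCommGroup D.Q := D.core.toNormedAddCommGroup

/-- The inner product on `Q` given by the real part of `Ω`. -/
instance : InnerProductSpace ℝ D.Q := InnerProductSpace.ofCore D.core.toCore

/-- The quotient map `L → Q`. -/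
def q : L →ₗ[ℝ] D.Q := D.M.mkQ

/-- The quotient map `A → C`. -/
def c (η : A) : D.C := Quotient.mk (quotSetoid D.M A) η

/-- `C` is an affine space over `Q`. -/
instance : AddTorsor D.Q D.C where
  vadd φ ϕ := Quotient.map₂ (sa := Submodule.quotientRel D.M) (sb := quotSetoid D.M A)
    (sc := quotSetoid D.M A) (fun ξ ζ => ξ +ᵥ ζ)
    (fun ξ ξ' h ζ ζ' h' => by
      have h₁ : ξ - ξ' ∈ D.M := (Submodule.quotientRel_def D.M).1 h
      have h₂ : ζ -ᵥ ζ' ∈ D.M := h'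
      change (ξ +ᵥ ζ) -ᵥ (ξ' +ᵥ ζ') ∈ D.M
      rw [vadd_vsub_vadd_comm]
      exact D.M.add_mem h₁ h₂) φ ϕ
  zero_vadd ϕ := by
    induction ϕ using Quotient.inductionOn with
    | _ ζ => exact congrArg D.c (zero_vadd L ζ)
  add_vadd φ φ' ϕ := by
    induction φ using Submodule.Quotient.induction_on with
    | _ ξ =>
      induction φ' using Submodule.Quotient.induction_on with
      | _ ξ' =>
        induction ϕ using Quotient.inductionOn with
        | _ ζ => exact congrArg D.c (add_vadd ξ ξ' ζ)
  vsub ϕ ϕ' := Quotient.liftOn₂ ϕ ϕ' (fun ζ ζ' => D.q (ζ -ᵥ ζ'))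
    (fun ζ₁ ζ₂ ζ₁' ζ₂' h h' => by
      have h₁ : ζ₁ -ᵥ ζ₁' ∈ D.M := h
      have h₂ : ζ₂ -ᵥ ζ₂' ∈ D.M := h'
      refine (Submodule.Quotient.eq D.M).2 ?_
      rw [vsub_sub_vsub_comm]
      exact D.M.sub_mem h₁ h₂)
  nonempty := (AddTorsor.nonempty (G := L) (P := A)).map D.c
  vsub_vadd' ϕ ϕ' := by
    induction ϕ using Quotient.inductionOn with
    | _ ζ =>
      induction ϕ' using Quotient.inductionOn with
      | _ ζ' => exact congrArg D.c (vsub_vadd ζ ζ')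
  vadd_vsub' φ ϕ := by
    induction φ using Submodule.Quotient.induction_on with
    | _ ξ =>
      induction ϕ using Quotient.inductionOn with
      | _ ζ => exact congrArg D.q (vadd_vsub ξ ζ)

/-- The symplectic potential as a map on `A × Q`. -/
def θQ (η : A) : D.Q →ₗ[ℝ] ℝ :=
  D.M.liftQ (D.θ η) fun τ hτ => LinearMap.mem_ker.2 (D.adapted η τ hτ)

/-- The bilinear form `bracket` as a map on `L × Q`. -/
def bracketQ (ξ : L) : D.Q →ₗ[ℝ] ℝ :=
  D.M.liftQ (D.bracket ξ) fun _ hτ => LinearMap.mem_ker.2 (hτ ξ)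

/-- The form `Ω` as a map on `Q × Q`. -/
def ΩQ (φ φ' : D.Q) : ℂ := D.Ω φ φ'

/-- `Ω` is admissible: `Q` is a separable Hilbert space for the real part of `Ω`, the imaginary
part of `Ω` is continuous on it, and the continuous linear functionals on it are exactly the maps
`φ ↦ [ξ, φ]` with `ξ ∈ L`. -/
class Admissible : Prop where
  complete : CompleteSpace D.Q
  separable : TopologicalSpace.SeparableSpace D.Q
  continuous_im : Continuous fun p : D.Q × D.Q => (D.ΩQ p.1 p.2).im
  continuous_bracket : ∀ ξ : L, Continuous (D.bracketQ ξ)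
  exists_bracket : ∀ l : StrongDual ℝ D.Q, ∃ ξ : L, ∀ φ : D.Q, l φ = D.bracketQ ξ φ

instance [D.Admissible] : CompleteSpace D.Q := Admissible.complete

/-- The wave function on `C` of the affine coherent state associated with `ζ ∈ A`. -/
def coherent (ζ : A) (ϕ : D.C) : ℂ :=
  cexp (I * (D.θQ ζ (ϕ -ᵥ D.c ζ) : ℂ) - 1 / 2 * D.ΩQ (ϕ -ᵥ D.c ζ) (ϕ -ᵥ D.c ζ))

/-- The `η`-reduced wave function, a function on `Q`, of a wave function `Ψ` on `C`; it is
characterized by `Ψ ϕ = reduced η Ψ (ϕ - c η) * coherent η ϕ`. -/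
def reduced (η : A) (Ψ : D.C → ℂ) (φ : D.Q) : ℂ :=
  Ψ (φ +ᵥ D.c η) / D.coherent η (φ +ᵥ D.c η)

/-- The quotient of coherent states relating the base points `η` and `η'`. -/
def β (η η' : A) (φ : D.Q) : ℂ :=
  D.coherent η (φ +ᵥ D.c η') / D.coherent η' (φ +ᵥ D.c η')

/-- The change of base point from `η` to `η'` for functions on the extension of `Q`. -/
def rebase (η η' : A) (ψ : Hat D.Q → ℂ) (Φ : Hat D.Q) : ℂ :=
  ψ (Φ + incl D.Q (D.q (η' -ᵥ η))) * cylExtend (D.β η η') Φ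

end SchrodingerData

end SchrodingerRep

end

open SchrodingerRep

noncomputable section

namespace SchrodingerRep

/-! ### Points of `Hat E`, cylindrical functions and density of `E` -/

section Extension

variable {E : Type*} [NormedAddCommGroup E] [InnerProductSpace ℝ E]

/-! Put a = q(η' - η). Seen from c(η), the point φ + c(η') has coordinate φ + a; seen from c(η') it
has coordinate φ. In the quotient of the two coherent states the term quadratic in φ therefore
cancels, and so does θ(η, φ). What remains is the exponential of a constant plus the functionals [η'
- η, ·], Re Ω(a, ·) and Im Ω(a, ·) (`β_eq`). Admissibility makes all three continuous, so β factors
through a finite-dimensional quotient and its formula makes sense verbatim on `Hat D.Q` (`βHat`).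
Since Q is dense in its extension (`denseRange_incl`), this is the only continuous extension, and
identities valid on Q carry over.

The isometry is a Cameron–Martin statement. For the Gaussian with density proportional to
exp(-‖x‖²), the translation x ↦ x + a carries the measure with density exp(-‖a‖² - 2⟨a, x⟩) back to
the Gaussian. This is completing the square in finite dimensions, and uniqueness of the projective
limit lifts it to `Hat E` (`map_translate_withDensity`). By `norm_βHat_sq`, |β|² is exactly this
density, so translating by a and multiplying by β preserves inner products. Exchanging η and η'
gives the inverse, because the corresponding quotients of coherent states telescope to 1. -/

theorem Hat.eval_add (Φ Φ' : Hat E) (l : StrongDual ℝ E) :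
    (Φ + Φ').eval l = Φ.eval l + Φ'.eval l := rfl

theorem Hat.eval_incl (x : E) (l : StrongDual ℝ E) : (incl E x).eval l = l x := rfl

theorem continuous_eval (l : StrongDual ℝ E) : Continuous fun Φ : Hat E => Φ.eval l :=
  (continuous_apply l).comp continuous_induced_dom

theorem proj_incl (W : FinCodim E) (x : E) : proj W (incl E x) = W.carrier.mkQ x := by
  -- Linear functionals separate the points of the quotient.
  refine sub_eq_zero.1 ((Module.forall_dual_apply_eq_zero_iff ℝ _).1 fun l => ?_)
  rw [map_sub, sub_eq_zero]
  rw [apply_proj]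
  rfl

/-- A representative of the projection to a finer quotient is one for the coarser quotient. -/
theorem proj_eq_of_le {W W' : FinCodim E} (h : W.carrier ≤ W'.carrier) {Φ : Hat E} {x : E}
    (hx : proj W Φ = W.carrier.mkQ x) : proj W' Φ = W'.carrier.mkQ x := by
  refine sub_eq_zero.1 ((Module.forall_dual_apply_eq_zero_iff ℝ _).1 fun l => ?_)
  rw [map_sub, sub_eq_zero]
  have h1 : pullback W' l = pullback W (l ∘ₗ Submodule.factor h) := by
    ext y
    rfl
  rw [apply_proj, h1, ← apply_proj, hx]
  rfl

theorem exists_proj_eq (W : FinCodim E) (Φ : Hat E) : ∃ x : E, proj W Φ = W.carrier.mkQ x := by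
  obtain ⟨x, hx⟩ := W.carrier.mkQ_surjective (proj W Φ)
  exact ⟨x, hx.symm⟩

/-- The intersection of two closed subspaces of finite codimension. -/
def FinCodim.inf (W W' : FinCodim E) : FinCodim E where
  carrier := W.carrier ⊓ W'.carrier
  isClosed := W.isClosed.inter W'.isClosed
  finiteDimensional := by
    -- As a kernel of a map into the product of the two quotients, the intersection has a quotient
    -- that embeds in a finite-dimensional space.
    have h : W.carrier ⊓ W'.carrier = (W.carrier.mkQ.prod W'.carrier.mkQ).ker := by
      rw [LinearMap.ker_prod, Submodule.ker_mkQ, Submodule.ker_mkQ]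
    rw [h]
    exact (LinearMap.quotKerEquivRange
      (W.carrier.mkQ.prod W'.carrier.mkQ)).symm.finiteDimensional

theorem FinCodim.inf_le_left (W W' : FinCodim E) : (W.inf W').carrier ≤ W.carrier :=
  _root_.inf_le_left

theorem FinCodim.inf_le_right (W W' : FinCodim E) : (W.inf W').carrier ≤ W'.carrier :=
  _root_.inf_le_right

/-- Every functional in `I` factors through the quotient by the common kernel. Hence finitely many
functionals cannot tell a point of `Hat E` from a suitable vector of `E`, which reduces computations
on `Hat E` to `E`. -/
theorem eval_eq_of_proj_commonKer {I : Finset (StrongDual ℝ E)} {Φ : Hat E} {x : E}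
    (hx : proj (commonKer I) Φ = (commonKer I).carrier.mkQ x) {l : StrongDual ℝ E} (hl : l ∈ I) :
    Φ.eval l = l x := by
  obtain ⟨l', hl'⟩ := exists_pullback_eq I ⟨l, hl⟩
  simp only at hl'
  rw [← hl', ← apply_proj, hx]
  rfl

theorem apply_eq_zero_of_mem_commonKer {I : Finset (StrongDual ℝ E)} {x : E}
    (hx : x ∈ (commonKer I).carrier) {l : StrongDual ℝ E} (hl : l ∈ I) : l x = 0 :=
  congrFun (LinearMap.mem_ker.1 hx) ⟨l, hl⟩

theorem DescendsTo.mono {W W' : FinCodim E} (h : W.carrier ≤ W'.carrier) {f : E → ℂ}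
    (hf : DescendsTo W' f) : DescendsTo W f :=
  fun x w hw => hf x w (h hw)

theorem DescendsTo.apply_eq {W : FinCodim E} {f : E → ℂ} (hf : DescendsTo W f) {x y : E}
    (h : W.carrier.mkQ x = W.carrier.mkQ y) : f x = f y := by
  have h1 := hf y (x - y) ((Submodule.Quotient.eq _).1 h)
  rwa [add_sub_cancel] at h1

/-- The canonical extension of a cylindrical function can be computed on any finite-dimensional
quotient to which the function descends. -/
theorem cylExtend_eq {W : FinCodim E} {f : E → ℂ} (hf : DescendsTo W f) {Φ : Hat E} {x : E}
    (hx : proj W Φ = W.carrier.mkQ x) : cylExtend f Φ = f x := by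
  have h : IsCylindrical f := ⟨W, hf⟩
  rw [cylExtend, dif_pos h]
  -- The definition uses a subspace picked by choice. A representative modulo the intersection
  -- represents `Φ` both for that subspace and for `W`, so the two values can be compared at `y`.
  obtain ⟨y, hy⟩ := exists_proj_eq (W.inf h.choose) Φ
  have h1 := proj_eq_of_le (W.inf_le_left h.choose) hy
  have h2 := proj_eq_of_le (W.inf_le_right h.choose) hy
  rw [hf.apply_eq (hx.symm.trans h1)]
  refine h.choose_spec.apply_eq ?_
  rw [← h2]
  exact Quotient.out_eq _

theorem continuous_incl : Continuous (incl E) :=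
  continuous_induced_rng.2 (continuous_pi fun l => l.continuous)

/-- A basic open set of the projective topology constrains only finitely many functionals, and on
those the values of `Φ` are attained by a vector of `E`. -/
theorem denseRange_incl : DenseRange (incl E) := by
  have hi : Topology.IsInducing fun (Φ : Hat E) (l : StrongDual ℝ E) => Φ.eval l := ⟨rfl⟩
  intro Φ
  rw [hi.closure_eq_preimage_closure_image]
  refine mem_closure_iff.2 fun o ho hΦ => ?_
  obtain ⟨I, u, hu, hIo⟩ := isOpen_pi_iff.1 ho _ hΦ
  obtain ⟨x, hx⟩ := exists_proj_eq (commonKer I) Φ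
  refine ⟨_, hIo fun l hl => ?_, Set.mem_image_of_mem _ ⟨x, rfl⟩⟩
  change l x ∈ u l
  rw [← eval_eq_of_proj_commonKer hx hl]
  exact (hu l hl).2

end Extension

/-! ### Cameron–Martin theorem for the Gaussian measure on `Hat E` -/

section CameronMartin

/-- Completing the square: the two exponents add up to -‖v + a‖², and Lebesgue measure is
translation invariant. -/
theorem map_withDensity_gaussian {V : Type*} [NormedAddCommGroup V] [InnerProductSpace ℝ V]
    [FiniteDimensional ℝ V] [MeasurableSpace V] [BorelSpace V] (a : V) :
    ((gaussian V).withDensity fun v =>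
      ENNReal.ofReal (Real.exp (-‖a‖ ^ 2 - 2 * inner ℝ a v))).map (· + a) = gaussian V := by
  refine Measure.ext fun s hs => ?_
  have hm : Measurable fun x : V => ENNReal.ofReal (Real.exp (-‖x‖ ^ 2)) := by fun_prop
  rw [Measure.map_apply (by fun_prop) hs,
    withDensity_apply _ (measurable_add_const a hs), gaussian, Measure.restrict_smul,
    lintegral_smul_measure, Measure.smul_apply, withDensity_apply _ hs]
  -- Both sides carry the same normalising constant.
  congr 1
  rw [restrict_withDensity (measurable_add_const a hs),
    lintegral_withDensity_eq_lintegral_mul _ hm (by fun_prop),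
    ← lintegral_indicator (measurable_add_const a hs), ← lintegral_indicator hs,
    ← lintegral_add_right_eq_self (s.indicator _) a]
  refine lintegral_congr fun v => ?_
  have hmem : v ∈ (· + a) ⁻¹' s ↔ v + a ∈ s := Iff.rfl
  by_cases hv : v + a ∈ s
  swap
  · rw [Set.indicator_of_notMem (mt hmem.1 hv), Set.indicator_of_notMem hv]
  rw [Set.indicator_of_mem (hmem.2 hv), Set.indicator_of_mem hv, Pi.mul_apply]
  rw [← ENNReal.ofReal_mul (Real.exp_pos _).le, ← Real.exp_add, norm_add_sq_real,
    real_inner_comm]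
  congr 2
  ring

variable {E : Type*} [NormedAddCommGroup E] [InnerProductSpace ℝ E]

/-- The quotient is isometric to the orthogonal complement of `W`. There `a` represents itself, and
the representative of `x` differs from `x` by an element of `W`, which is orthogonal to `a`. -/
theorem inner_mkQ_mkQ [CompleteSpace E] {W : FinCodim E} {a : E} (ha : a ∈ W.carrierᗮ) (x : E) :
    inner ℝ (W.carrier.mkQ a) (W.carrier.mkQ x) = inner ℝ a x := by
  let e := W.carrier.quotientEquivOrthogonal
  have h1 : ∀ t : W.Quot, W.carrier.mkQ ((e t : W.carrierᗮ) : E) = t := by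
    intro t
    have := W.carrier.quotientEquivOrthogonal_symm_eq_mk (e t : E) (e t).2
    rw [Submodule.mkQ_apply, ← this]
    exact e.symm_apply_apply t
  have h2 : ((e (W.carrier.mkQ a) : W.carrierᗮ) : E) = a := by
    have := W.carrier.quotientEquivOrthogonal_symm_eq_mk a ha
    rw [Submodule.mkQ_apply, ← this]
    exact congrArg Subtype.val (e.apply_symm_apply ⟨a, ha⟩)
  have h3 : x - e (W.carrier.mkQ x) ∈ W.carrier := (Submodule.Quotient.eq _).1 (h1 _).symm
  have h4 := Submodule.inner_left_of_mem_orthogonal h3 ha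
  rw [inner_sub_right, sub_eq_zero] at h4
  rw [← e.inner_map_map, Submodule.coe_inner, h2, h4]

theorem measurable_add_incl (a : E) : Measurable fun Φ : Hat E => Φ + incl E a :=
  measurable_hat fun l => (measurable_eval l).add_const (l a)

/-- Translation by an element of `E` as a measurable equivalence of `Hat E`. -/
def translate (a : E) : Hat E ≃ᵐ Hat E where
  toEquiv := Equiv.addRight (incl E a)
  measurable_toFun := measurable_add_incl a
  measurable_invFun := by
    have h : ⇑(Equiv.addRight (incl E a)).symm = fun Φ : Hat E => Φ + incl E (-a) := by
      funext Φ
      rw [map_neg]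
      rfl
    rw [h]
    exact measurable_add_incl (-a)

/-- The density of the Gaussian measure translated by `-a` with respect to the Gaussian measure. -/
def translateDensity (a : E) (Φ : Hat E) : NNReal :=
  (Real.exp (-‖a‖ ^ 2 - 2 * Φ.eval (innerSL ℝ a))).toNNReal

theorem measurable_translateDensity (a : E) : Measurable (translateDensity a) := by
  have := measurable_eval (innerSL ℝ a)
  unfold translateDensity
  fun_prop

variable [CompleteSpace E]

theorem isProjectiveGaussian_gaussianHat : IsProjectiveGaussian (gaussianHat E) :=
  (existsUnique_projectiveGaussian E).choose_spec.1

theorem eq_gaussianHat {ν : Measure (Hat E)} (h : IsProjectiveGaussian ν) : ν = gaussianHat E :=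
  isProjectiveGaussian_unique h isProjectiveGaussian_gaussianHat

/-- The Cameron–Martin theorem for `gaussianHat E`. -/
theorem map_translate_withDensity (a : E) :
    ((gaussianHat E).withDensity fun Φ => (translateDensity a Φ : ENNReal)).map (translate a) =
      gaussianHat E := by
  refine eq_gaussianHat fun W => ?_
  -- Shrinking `W` so that ⟨a, ·⟩ vanishes on it makes the density a function on the quotient and
  -- puts `a` in the orthogonal complement, so that norms and inner products with `a` survive the
  -- projection.
  let W' := W.inf (commonKer {innerSL ℝ a})
  have ha : a ∈ W'.carrierᗮ := by
    refine (Submodule.mem_orthogonal' _ _).2 fun x hx => ?_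
    exact apply_eq_zero_of_mem_commonKer (W.inf_le_right _ hx) (Finset.mem_singleton_self _)
  let d : W'.Quot → ENNReal := fun v => ENNReal.ofReal
    (Real.exp (-‖W'.carrier.mkQ a‖ ^ 2 - 2 * inner ℝ (W'.carrier.mkQ a) v))
  have hd : Measurable d := by fun_prop
  have hdens : (fun Φ : Hat E => (translateDensity a Φ : ENNReal)) = d ∘ proj W' := by
    funext Φ
    obtain ⟨x, hx⟩ := exists_proj_eq W' Φ
    have h1 := eval_eq_of_proj_commonKer (proj_eq_of_le (W.inf_le_right _) hx)
      (Finset.mem_singleton_self (innerSL ℝ a))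
    change ENNReal.ofReal _ = ENNReal.ofReal _
    rw [h1, hx, inner_mkQ_mkQ ha, ← real_inner_self_eq_norm_sq (W'.carrier.mkQ a),
      inner_mkQ_mkQ ha, real_inner_self_eq_norm_sq, innerSL_apply_apply]
  have hcomm : proj W' ∘ translate a = (· + W'.carrier.mkQ a) ∘ proj W' := by
    funext Φ
    change proj W' (Φ + incl E a) = _
    rw [map_add, proj_incl]
    rfl
  have hpush : ((gaussianHat E).withDensity (d ∘ proj W')).map (proj W') =
      (gaussian W'.Quot).withDensity d := by
    refine Measure.ext fun s hs => ?_
    rw [Measure.map_apply (measurable_proj _) hs, withDensity_apply _ (measurable_proj _ hs),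
      withDensity_apply _ hs, ← isProjectiveGaussian_gaussianHat W',
      setLIntegral_map hs hd (measurable_proj _)]
    rfl
  have key : (((gaussianHat E).withDensity fun Φ => (translateDensity a Φ : ENNReal)).map
      (translate a)).map (proj W') = (gaussianHat E).map (proj W') := by
    rw [Measure.map_map (measurable_proj _) (translate a).measurable, hcomm,
      ← Measure.map_map (by fun_prop) (measurable_proj _), hdens, hpush,
      isProjectiveGaussian_gaussianHat W']
    exact map_withDensity_gaussian _
  -- The equality on the finer quotient is pushed forward to the original one.
  let r : W'.Quot →ₗ[ℝ] W.Quot := Submodule.factor (W.inf_le_left _)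
  have hr : Measurable r := (LinearMap.continuous_of_finiteDimensional r).measurable
  have hproj : (proj W : Hat E → W.Quot) = r ∘ proj W' := by
    funext Φ
    obtain ⟨x, hx⟩ := exists_proj_eq W' Φ
    rw [proj_eq_of_le (W.inf_le_left _) hx, Function.comp_apply, hx]
    rfl
  rw [hproj, ← Measure.map_map hr (measurable_proj _), key,
    Measure.map_map hr (measurable_proj _), ← hproj, isProjectiveGaussian_gaussianHat W]

/-- Cameron–Martin as a change of variables. Since the translation is a measurable equivalence and
the density is measurable with values in `NNReal`, `f` may be arbitrary. -/
theorem integral_translate (a : E) (f : Hat E → ℂ) :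
    ∫ Φ, (translateDensity a Φ : ℝ) • f (Φ + incl E a) ∂(gaussianHat E) =
      ∫ Φ, f Φ ∂(gaussianHat E) := by
  conv_rhs => rw [← map_translate_withDensity a, integral_map_equiv,
    integral_withDensity_eq_integral_smul (measurable_translateDensity a)]
  rfl

theorem lintegral_translate (a : E) (f : Hat E → ENNReal) :
    ∫⁻ Φ, translateDensity a Φ * f (Φ + incl E a) ∂(gaussianHat E) =
      ∫⁻ Φ, f Φ ∂(gaussianHat E) := by
  conv_rhs => rw [← map_translate_withDensity a, lintegral_map_equiv,
    lintegral_withDensity_eq_lintegral_mul_non_measurable _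
      (measurable_translateDensity a).coe_nnreal_ennreal
      (Filter.Eventually.of_forall fun _ => ENNReal.coe_lt_top)]
  rfl

/-- The density vanishes nowhere, so the Gaussian is absolutely continuous with respect to its
weighted version, whose translate is the Gaussian again. This lets almost everywhere strong
measurability survive translation. -/
theorem quasiMeasurePreserving_translate (a : E) :
    Measure.QuasiMeasurePreserving (translate a) (gaussianHat E) (gaussianHat E) := by
  refine ⟨(translate a).measurable, ?_⟩
  conv_rhs => rw [← map_translate_withDensity a]
  refine Measure.AbsolutelyContinuous.map ?_ (translate a).measurable
  refine withDensity_absolutelyContinuous'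
    (measurable_translateDensity a).coe_nnreal_ennreal.aemeasurable
    (Filter.Eventually.of_forall fun Φ => ?_)
  exact ENNReal.coe_ne_zero.2 (Real.toNNReal_pos.2 (Real.exp_pos _)).ne'

/-- Multiplying a translate by a factor whose squared absolute value is the Cameron–Martin density
preserves square-integrability. -/
theorem memLp_translate_mul {a : E} {b ψ : Hat E → ℂ} (hb : Measurable b)
    (hba : ∀ Φ, ‖b Φ‖ ^ 2 = translateDensity a Φ) (hψ : MemLp ψ 2 (gaussianHat E)) :
    MemLp (fun Φ => ψ (Φ + incl E a) * b Φ) 2 (gaussianHat E) := by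
  refine ⟨(hψ.1.comp_quasiMeasurePreserving (quasiMeasurePreserving_translate a)).mul
    hb.aestronglyMeasurable, ?_⟩
  have h := hψ.2
  rw [eLpNorm_lt_top_iff_lintegral_rpow_enorm_lt_top two_ne_zero ENNReal.ofNat_ne_top] at h ⊢
  -- The two integrals of squared norms are in fact equal.
  refine lt_of_eq_of_lt ?_ h
  rw [← lintegral_translate a fun Φ => ‖ψ Φ‖ₑ ^ ENNReal.toReal 2]
  refine lintegral_congr fun Φ => ?_
  simp only [ENNReal.toReal_ofNat, ENNReal.rpow_ofNat, enorm_mul, mul_pow]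
  rw [mul_comm]
  congr 1
  rw [← enorm_pow, ← enorm_norm, norm_pow, hba, enorm_eq_nnnorm]
  simp

end CameronMartin

/-! ### Change of base point on Q -/

namespace SchrodingerData

variable {A L : Type*} [AddCommGroup L] [Module ℝ L] [AddTorsor L A] (D : SchrodingerData A L)

theorem coherent_ne_zero (ζ : A) (ϕ : D.C) : D.coherent ζ ϕ ≠ 0 := Complex.exp_ne_zero _

theorem c_vsub_c (η η' : A) : D.c η' -ᵥ D.c η = D.q (η' -ᵥ η) := rfl

/-- One point of C in the coordinates centred at c(η) and at c(η'). -/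
theorem vadd_c_eq (η η' : A) (φ : D.Q) : (φ + D.q (η' -ᵥ η)) +ᵥ D.c η = φ +ᵥ D.c η' := by
  rw [← c_vsub_c, add_vadd, vsub_vadd]

theorem θQ_apply_eq (η η' : A) (φ : D.Q) :
    D.θQ η' φ = D.θQ η φ + D.bracketQ (η' -ᵥ η) φ := by
  obtain ⟨τ, rfl⟩ := D.M.mkQ_surjective φ
  have h := D.equivariant η (η' -ᵥ η) τ
  rw [vsub_vadd] at h
  exact h

theorem ΩQ_add_add (a φ : D.Q) :
    D.ΩQ (φ + a) (φ + a) = D.ΩQ φ φ + 2 * D.ΩQ a φ + D.ΩQ a a := by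
  have h : D.ΩQ (φ + a) (φ + a) = (D.ΩQ φ φ + D.ΩQ φ a) + (D.ΩQ a φ + D.ΩQ a a) := by
    exact (D.Ω.map_add₂ φ a _).trans 
      (congrArg₂ (· + ·) ((D.Ω φ).map_add φ a) ((D.Ω a).map_add φ a))
  have hs : D.ΩQ φ a = D.ΩQ a φ := D.symm φ a
  rw [h, hs]
  ring

theorem β_eq (η η' : A) (φ : D.Q) : D.β η η' φ =
    Complex.exp (Complex.I * (D.θ η (η' -ᵥ η) : ℂ)
      - 1 / 2 * D.ΩQ (D.q (η' -ᵥ η)) (D.q (η' -ᵥ η))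
      - Complex.I * (D.bracketQ (η' -ᵥ η) φ : ℂ) - D.ΩQ (D.q (η' -ᵥ η)) φ) := by
  have hθ : D.θ η (η' -ᵥ η) = D.θQ η (D.q (η' -ᵥ η)) := rfl
  -- The point is first written relative to c(η) to evaluate the numerator, then the remaining
  -- occurrences are put back relative to c(η') for the denominator.
  rw [β, coherent, coherent, ← Complex.exp_sub, ← vadd_c_eq D η η', vadd_vsub, vadd_c_eq,
    vadd_vsub, D.θQ_apply_eq η η', map_add, ΩQ_add_add, hθ]
  congr 1
  push_cast
  ring

/-- After the shift both quotients are evaluated at the same point of C, so they are reciprocal. -/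
theorem β_mul_β (η η' : A) (φ : D.Q) :
    D.β η η' (φ + D.q (η -ᵥ η')) * D.β η' η φ = 1 := by
  rw [β, β, vadd_c_eq, div_mul_div_cancel₀ (D.coherent_ne_zero _ _),
    div_self (D.coherent_ne_zero _ _)]

theorem reduced_eq (η η' : A) (Ψ : D.C → ℂ) (φ : D.Q) :
    D.reduced η' Ψ φ = D.reduced η Ψ (φ + D.q (η' -ᵥ η)) * D.β η η' φ := by
  rw [reduced, reduced, β, vadd_c_eq, div_mul_div_cancel₀ (D.coherent_ne_zero _ _)]

/-! ### The factor β on the extension of Q -/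

variable [D.Admissible]

/-- The form `bracket ξ` as a continuous linear functional on `Q`. -/
def bracketL (ξ : L) : StrongDual ℝ D.Q := ⟨D.bracketQ ξ, Admissible.continuous_bracket ξ⟩

/-- The imaginary part of `Ω` as a continuous linear functional in the second argument. -/
def imL (a : D.Q) : StrongDual ℝ D.Q :=
  ⟨Complex.imLm ∘ₗ D.Ω a,
    (Admissible.continuous_im (D := D)).comp (Continuous.prodMk_right a)⟩

theorem ΩQ_eq (a φ : D.Q) : D.ΩQ a φ = (innerSL ℝ a φ : ℝ) + (D.imL a φ : ℝ) * I :=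
  (Complex.re_add_im _).symm

/-- The function on the extension of `Q` given by the explicit formula for `β`. -/
def βHat (η η' : A) (Φ : Hat D.Q) : ℂ :=
  Complex.exp (I * (D.θ η (η' -ᵥ η) : ℂ)
    - 1 / 2 * D.ΩQ (D.q (η' -ᵥ η)) (D.q (η' -ᵥ η)) - I * (Φ.eval (D.bracketL (η' -ᵥ η)) : ℂ)
    - (Φ.eval (innerSL ℝ (D.q (η' -ᵥ η))) + Φ.eval (D.imL (D.q (η' -ᵥ η))) * I))

theorem βHat_incl (η η' : A) (φ : D.Q) : D.βHat η η' (incl D.Q φ) = D.β η η' φ := by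
  rw [β_eq, D.ΩQ_eq _ φ]
  rfl

theorem continuous_βHat (η η' : A) : Continuous (D.βHat η η') := by
  have h1 := continuous_eval (D.bracketL (η' -ᵥ η))
  have h2 := continuous_eval (innerSL ℝ (D.q (η' -ᵥ η)))
  have h3 := continuous_eval (D.imL (D.q (η' -ᵥ η)))
  unfold βHat
  fun_prop

theorem measurable_βHat (η η' : A) : Measurable (D.βHat η η') := by
  have h1 := measurable_eval (D.bracketL (η' -ᵥ η))
  have h2 := measurable_eval (innerSL ℝ (D.q (η' -ᵥ η)))
  have h3 := measurable_eval (D.imL (D.q (η' -ᵥ η)))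
  unfold βHat
  fun_prop

/-- The terms with θ, the bracket and Im Ω are pure phases. The real part of the exponent is -‖a‖²/2
- ⟨a, ·⟩ with a = q(η' - η), and squaring doubles it to the Cameron–Martin exponent. -/
theorem norm_βHat_sq (η η' : A) (Φ : Hat D.Q) :
    ‖D.βHat η η' Φ‖ ^ 2 = translateDensity (D.q (η' -ᵥ η)) Φ := by
  have h : (D.ΩQ (D.q (η' -ᵥ η)) (D.q (η' -ᵥ η))).re = ‖D.q (η' -ᵥ η)‖ ^ 2 :=
    real_inner_self_eq_norm_sq (D.q (η' -ᵥ η))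
  rw [translateDensity, Real.coe_toNNReal _ (Real.exp_pos _).le, βHat, Complex.norm_exp,
    ← Real.exp_nat_mul, ← h]
  congr 1
  simp
  ring

open Classical in
/-- A closed subspace of finite codimension to which `β` descends. -/
def βCodim (η η' : A) : FinCodim D.Q :=
  commonKer {D.bracketL (η' -ᵥ η), innerSL ℝ (D.q (η' -ᵥ η)), D.imL (D.q (η' -ᵥ η))}

theorem descendsTo_β (η η' : A) : DescendsTo (D.βCodim η η') (D.β η η') := by
  intro x w hw
  have h1 := apply_eq_zero_of_mem_commonKer hw (l := D.bracketL (η' -ᵥ η)) (by simp)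
  have h2 := apply_eq_zero_of_mem_commonKer hw (l := innerSL ℝ (D.q (η' -ᵥ η))) (by simp)
  have h3 := apply_eq_zero_of_mem_commonKer hw (l := D.imL (D.q (η' -ᵥ η))) (by simp)
  rw [← βHat_incl, ← βHat_incl, map_add]
  simp only [βHat, Hat.eval_add, Hat.eval_incl, h1, h2, h3, add_zero]

theorem isCylindrical_β (η η' : A) : IsCylindrical (D.β η η') := ⟨_, D.descendsTo_β η η'⟩

/-- A representative of `Φ` modulo `βCodim` agrees with `Φ` on the three functionals in the
exponent. -/
theorem cylExtend_β (η η' : A) : cylExtend (D.β η η') = D.βHat η η' := by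
  funext Φ
  obtain ⟨x, hx⟩ := exists_proj_eq (D.βCodim η η') Φ
  rw [cylExtend_eq (D.descendsTo_β η η') hx, ← βHat_incl, βHat, βHat,
    eval_eq_of_proj_commonKer hx (l := D.bracketL (η' -ᵥ η)) (by simp),
    eval_eq_of_proj_commonKer hx (l := innerSL ℝ (D.q (η' -ᵥ η))) (by simp),
    eval_eq_of_proj_commonKer hx (l := D.imL (D.q (η' -ᵥ η))) (by simp)]
  rfl

theorem continuous_β (η η' : A) : Continuous (D.β η η') := by
  have h : D.β η η' = D.βHat η η' ∘ incl D.Q := funext fun φ => (D.βHat_incl η η' φ).symm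
  rw [h]
  exact (D.continuous_βHat η η').comp continuous_incl

theorem eq_cylExtend_β_iff (η η' : A) (b : Hat D.Q → ℂ) :
    (Continuous b ∧ ∀ φ : D.Q, b (incl D.Q φ) = D.β η η' φ) ↔ b = cylExtend (D.β η η') := by
  rw [cylExtend_β]
  constructor
  · rintro ⟨hb, h⟩
    exact denseRange_incl.equalizer hb (D.continuous_βHat η η')
      (funext fun φ => (h φ).trans (D.βHat_incl η η' φ).symm)
  · rintro rfl
    exact ⟨D.continuous_βHat η η', D.βHat_incl η η'⟩

theorem cylExtend_reduced (η η' : A) (Ψ : D.C → ℂ) (h : IsCylindrical (D.reduced η Ψ)) :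
    IsCylindrical (D.reduced η' Ψ) ∧
      cylExtend (D.reduced η' Ψ) = D.rebase η η' (cylExtend (D.reduced η Ψ)) := by
  obtain ⟨W, hW⟩ := h
  -- Both factors of the product formula descend to the quotient by the intersection, hence so does
  -- the product.
  let W' := W.inf (D.βCodim η η')
  have hr : DescendsTo W' (D.reduced η Ψ) := hW.mono (W.inf_le_left _)
  have hβ : DescendsTo W' (D.β η η') := (D.descendsTo_β η η').mono (W.inf_le_right _)
  have hr' : DescendsTo W' (D.reduced η' Ψ) := by
    intro x w hw
    rw [D.reduced_eq η η', D.reduced_eq η η', hβ x w hw, add_right_comm, hr _ w hw]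
  refine ⟨⟨W', hr'⟩, funext fun Φ => ?_⟩
  obtain ⟨x, hx⟩ := exists_proj_eq W' Φ
  have hx' : proj W' (Φ + incl D.Q (D.q (η' -ᵥ η))) = W'.carrier.mkQ (x + D.q (η' -ᵥ η)) := by
    rw [map_add, map_add, proj_incl, hx]
  rw [rebase, cylExtend_eq hr' hx, cylExtend_eq hr hx', cylExtend_eq hβ hx, ← reduced_eq]

/-! ### Invertibility and isometry on square-integrable functions -/

theorem βHat_mul_βHat (η η' : A) (Φ : Hat D.Q) :
    D.βHat η η' (Φ + incl D.Q (D.q (η -ᵥ η'))) * D.βHat η' η Φ = 1 := by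
  have hc : Continuous fun Φ : Hat D.Q => Φ + incl D.Q (D.q (η -ᵥ η')) :=
    continuous_induced_rng.2 (continuous_pi fun l => (continuous_eval l).add_const _)
  -- Both sides are continuous, so it suffices to check the identity on the dense subspace Q.
  refine congrFun (denseRange_incl.equalizer
    (((D.continuous_βHat η η').comp hc).mul (D.continuous_βHat η' η)) continuous_const
    (funext fun φ => ?_) : _ = fun _ => (1 : ℂ)) Φ
  have h : D.βHat η η' (incl D.Q (φ + D.q (η -ᵥ η'))) * D.βHat η' η (incl D.Q φ) = 1 := by
    rw [βHat_incl, βHat_incl, β_mul_β]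
  rwa [map_add] at h

theorem rebase_eq (η η' : A) (ψ : Hat D.Q → ℂ) (Φ : Hat D.Q) :
    D.rebase η η' ψ Φ = ψ (Φ + incl D.Q (D.q (η' -ᵥ η))) * D.βHat η η' Φ := by
  rw [rebase, cylExtend_β]

/-- The two translations are opposite and the two factors are reciprocal. -/
theorem rebase_rebase (η η' : A) (ψ : Hat D.Q → ℂ) :
    D.rebase η' η (D.rebase η η' ψ) = ψ := by
  funext Φ
  have h : incl D.Q (D.q (η -ᵥ η')) + incl D.Q (D.q (η' -ᵥ η)) = 0 := by
    rw [← map_add, ← map_add, vsub_add_vsub_cancel, vsub_self, map_zero, map_zero]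
  rw [rebase_eq, rebase_eq, mul_assoc, βHat_mul_βHat, mul_one, add_assoc, h, add_zero]

theorem rebase_mem_sqInt (η η' : A) {ψ : Hat D.Q → ℂ} (hψ : ψ ∈ SqInt D.Q) :
    D.rebase η η' ψ ∈ SqInt D.Q := by
  have h : D.rebase η η' ψ = fun Φ => ψ (Φ + incl D.Q (D.q (η' -ᵥ η))) * D.βHat η η' Φ :=
    funext (D.rebase_eq η η' ψ)
  rw [h]
  exact memLp_translate_mul (D.measurable_βHat η η') (D.norm_βHat_sq η η') hψ

/-- The change of base point as a linear automorphism of the space of square-integrable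
functions. -/
def rebaseEquiv (η η' : A) : SqInt D.Q ≃ₗ[ℂ] SqInt D.Q where
  toFun ψ := ⟨D.rebase η η' ψ, D.rebase_mem_sqInt η η' ψ.2⟩
  invFun ψ := ⟨D.rebase η' η ψ, D.rebase_mem_sqInt η' η ψ.2⟩
  map_add' _ _ := Subtype.ext (funext fun _ => add_mul _ _ _)
  map_smul' _ _ := Subtype.ext (funext fun _ => mul_assoc _ _ _)
  left_inv ψ := Subtype.ext (D.rebase_rebase η η' ψ)
  right_inv ψ := Subtype.ext (D.rebase_rebase η' η ψ)

/-- The factor enters the integrand once plainly and once conjugated, that is, as |β|², which is the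
density in `integral_translate`. -/
theorem innerProd_rebase (η η' : A) (χ ψ : Hat D.Q → ℂ) :
    innerProd (D.rebase η η' χ) (D.rebase η η' ψ) = innerProd χ ψ := by
  rw [innerProd, innerProd,
    ← integral_translate (D.q (η' -ᵥ η)) fun Φ => ψ Φ * starRingEnd ℂ (χ Φ)]
  refine integral_congr_ae (Filter.Eventually.of_forall fun Φ => ?_)
  simp only
  rw [rebase_eq, rebase_eq, ← norm_βHat_sq, Complex.real_smul, Complex.ofReal_pow,
    ← Complex.mul_conj', map_mul]
  ring

end SchrodingerData

end SchrodingerRep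

end

/-! ### The lemma on change of base point -/

theorem mainTheorem10 {A L : Type*} [AddCommGroup L] [Module ℝ L] [AddTorsor L A]
    (D : SchrodingerData A L) [D.Admissible] (η η' : A) :
    -- the explicit form of the quotient of coherent states, which is continuous and almost
    -- translation invariant
    (∀ φ : D.Q, D.β η η' φ =
      Complex.exp (Complex.I * (D.θ η (η' -ᵥ η) : ℂ)
        - 1 / 2 * D.ΩQ (D.q (η' -ᵥ η)) (D.q (η' -ᵥ η))
        - Complex.I * (D.bracketQ (η' -ᵥ η) φ : ℂ) - D.ΩQ (D.q (η' -ᵥ η)) φ)) ∧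
    Continuous (D.β η η') ∧
    IsCylindrical (D.β η η') ∧
    -- it is well defined on the extension of `Q`: its canonical extension does not depend on the
    -- finite-dimensional quotient used, and is its unique continuous extension
    (∀ W : FinCodim D.Q, DescendsTo W (D.β η η') → ∀ (Φ : Hat D.Q) (φ : D.Q),
      proj W Φ = W.carrier.mkQ φ → cylExtend (D.β η η') Φ = D.β η η' φ) ∧
    (∀ b : Hat D.Q → ℂ,
      (Continuous b ∧ ∀ φ : D.Q, b (incl D.Q φ) = D.β η η' φ) ↔ b = cylExtend (D.β η η')) ∧
    -- the change of base point sends `η`-reduced to `η'`-reduced wave functions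
    (∀ (Ψ : D.C → ℂ) (φ : D.Q),
      D.reduced η' Ψ φ = D.reduced η Ψ (φ + D.q (η' -ᵥ η)) * D.β η η' φ) ∧
    (∀ Ψ : D.C → ℂ, IsCylindrical (D.reduced η Ψ) →
      IsCylindrical (D.reduced η' Ψ) ∧
        cylExtend (D.reduced η' Ψ) = D.rebase η η' (cylExtend (D.reduced η Ψ))) ∧
    -- it preserves square-integrability
    (∀ ψ : Hat D.Q → ℂ, ψ ∈ SqInt D.Q → D.rebase η η' ψ ∈ SqInt D.Q) ∧
    -- and is an isometric isomorphism of the space of square-integrable functions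
    ∃ T : SqInt D.Q ≃ₗ[ℂ] SqInt D.Q,
      (∀ ψ : SqInt D.Q, (T ψ : Hat D.Q → ℂ) = D.rebase η η' ψ) ∧
      ∀ χ ψ : SqInt D.Q, innerProd (T χ : Hat D.Q → ℂ) (T ψ) = innerProd (χ : Hat D.Q → ℂ) ψ := by
  exact ⟨D.β_eq η η', D.continuous_β η η', D.isCylindrical_β η η',
    fun W hW Φ φ hφ => cylExtend_eq hW hφ, D.eq_cylExtend_β_iff η η', D.reduced_eq η η',
    D.cylExtend_reduced η η', fun ψ hψ => D.rebase_mem_sqInt η η' hψ,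
    D.rebaseEquiv η η', fun ψ => rfl, fun χ ψ => D.innerProd_rebase η η' χ ψ⟩
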